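/- Let $L>0$, let $a\in C^2(\mathbb R,\mathbb R)$ be positive and $L$-periodic, and let $f\in C^1(\mathbb R^2,\mathbb R)$ satisfy $f(x+L,u)=f(x,u)$ for all $(x,u)$. Consider the equation $$\partial_t u=\partial_x\big(a(x)\,\partial_x u\big)+f(x,u),\qquad (t,x)\in\mathbb R\times\mathbb R. \tag{E}$$ For $L$-periodic $C^2$ stationary solutions $r<q$ of (E), a *pulsating wave connecting $r$ to $q$ with speed $c\in\mathbb R$* is a classical entire solution of (E) of the form $u(t,x)=P(x-ct,x)$, where $P(z,x)$ is $L$-periodic in $x$, $P(z,\cdot)\to q$ uniformly as $z\to-\infty$ and $P(z,\cdot)\to r$ uniformly as $z\to+\infty$. A function $u_1(t,x)$ is *steeper than* $u_2(t,x)$ if, for all $x_1,t_1,t_2\in\mathbb R$, the equality $u_1(t_1,x_1)=u_2(t_2,x_1)$ implies $u_1(t_1,x)\ge u_2(t_2,x)$ for all $x\le x_1$ and $u_1(t_1,x)\le u_2(t_2,x)$ for all $x\ge x_1$. For an $L$-periodic function $g$, the *principal eigenvalue* $\mu_g$ is the real number for which there is a positive $L$-periodic $\varphi\in C^2(\mathbb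 R)$ with $(a\varphi')'+g\varphi=\mu_g\varphi$ on $\mathbb R$. Let $q,q_1,q_2$ be $L$-periodic stationary solutions of (E) with $q_1<q$ and $q_2<q$ on $\mathbb R$, and let $U_1,U_2$ be pulsating waves connecting $q_1$ to $q$ and $q_2$ to $q$, with speeds $c_1$ and $c_2$ respectively, where $U_1\le q$ on $\mathbb R^2$. Assume that there are $\delta>0$ and an $L$-periodic function $g$ that has a principal eigenvalue $\mu_g\le 0$ such that $$\partial_u f(x,u)\le g(x)\quad\text{for all }x\in\mathbb R\text{ and }u\in[q(x)-\delta,q(x)],$$ and assume that $U_1$ is steeper than $U_2$. Then $c_1\le c_2$. Moreover, if $c_1=c_2\neq 0$, then there is $\tau\in\mathbb R$ such that $U_2(t,x)=U_1(t+\tau,x)$ for all $(t,x)\in\mathbb R^2$. -/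

import Mathlib

open Filter Topology

namespace PeriodicRD

/-- A classical entire solution `u(t,x)` of `∂ₜ u = ∂ₓ (a(x) ∂ₓ u) + f(x,u)` on `ℝ × ℝ`:
`u` is `C¹` in `t` and `C²` in `x`, and satisfies the equation at every point. -/
structure IsEntireSolution (a : ℝ → ℝ) (f : ℝ → ℝ → ℝ) (u : ℝ → ℝ → ℝ) : Prop where
  cont : Continuous fun z : ℝ × ℝ => u z.1 z.2
  diff_t : ∀ x, Differentiable ℝ fun t => u t x
  diff_x : ∀ t, Differentiable ℝ (u t)
  diff_xx : ∀ t, Differentiable ℝ (deriv (u t))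
  cont_t : Continuous fun z : ℝ × ℝ => deriv (fun s => u s z.2) z.1
  cont_x : Continuous fun z : ℝ × ℝ => deriv (u z.1) z.2
  cont_xx : Continuous fun z : ℝ × ℝ => deriv (deriv (u z.1)) z.2
  eqn : ∀ t x, deriv (fun s => u s x) t
    = deriv (fun y => a y * deriv (u t) y) x + f x (u t x)

/-- An `L`-periodic stationary solution `q` of the equation. -/
structure IsPeriodicStationary (L : ℝ) (a : ℝ → ℝ) (f : ℝ → ℝ → ℝ) (q : ℝ → ℝ) : Prop where
  smooth : ContDiff ℝ 2 q
  periodic : Function.Periodic q L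
  eqn : ∀ x, deriv (fun y => a y * deriv q y) x + f x (q x) = 0

/-- `u` is a pulsating traveling wave of speed `c` connecting `r` to `q`: the `L`-periodic
stationary solution `q` is the limit on the left and `r` the limit on the right. The function
`P` is the profile, `u(t,x) = P(x - c t, x)`. -/
structure IsPulsatingWave (L : ℝ) (a : ℝ → ℝ) (f : ℝ → ℝ → ℝ) (c : ℝ) (r q : ℝ → ℝ)
    (u : ℝ → ℝ → ℝ) : Prop where
  right_state : IsPeriodicStationary L a f r
  left_state : IsPeriodicStationary L a f q
  solution : IsEntireSolution a f u
  profile : ∃ P : ℝ → ℝ → ℝ,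
    (∀ z, Function.Periodic (P z) L) ∧
    (∀ t x, u t x = P (x - c * t) x) ∧
    TendstoUniformly P q atBot ∧
    TendstoUniformly P r atTop

/-- `u₁` is steeper than `u₂`. -/
def Steeper (u₁ u₂ : ℝ → ℝ → ℝ) : Prop :=
  ∀ x₁ t₁ t₂ : ℝ, u₁ t₁ x₁ = u₂ t₂ x₁ →
    (∀ x ≤ x₁, u₂ t₂ x ≤ u₁ t₁ x) ∧ (∀ x, x₁ ≤ x → u₁ t₁ x ≤ u₂ t₂ x)

/-- `μ` is the principal eigenvalue of `φ ↦ (a φ')' + g φ` on `L`-periodic functions, that is,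
the eigenvalue that has a positive eigenfunction. -/
def IsPrincipalEigenvalue (L : ℝ) (a g : ℝ → ℝ) (μ : ℝ) : Prop :=
  ∃ φ : ℝ → ℝ, ContDiff ℝ 2 φ ∧ Function.Periodic φ L ∧ (∀ x, 0 < φ x) ∧
    ∀ x, deriv (fun y => a y * deriv φ y) x + g x * φ x = μ * φ x

end PeriodicRD

namespace PeriodicRD

/-! ### Maximum principles -/

/-! The proof slides one wave under the other. Fix a line moving with `U₂`, to the left of which
`U₂` is close to `q`. If `U₁ ≤ U₂` on that line, steepness extends the order to the right of it. To
the left, the order comes from a maximum principle: since `μ ≤ 0`, positive multiples of the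
eigenfunction `φ` are supersolutions of the equation linearized with coefficient `g`, and `g` bounds
the growth of `f` there (`le_left_of_faster`, `le_left_of_speed_eq`).

If `c₁ > c₂`, then `U₁` lies below `U₂` on the line in the far past but must overtake it. Up to the
first contact time on the line the waves are ordered everywhere, and the strong comparison principle
`lt_of_le_of_lt` excludes that contact (`speed_le`).

If `c₁ = c₂ ≠ 0`, take the largest shift that keeps `U₁` below `U₂`. Were the shifted waves
different, they would be strictly ordered everywhere. The invariance of both under `(L / c, L)`
makes the line compact modulo periods, so the shift could be increased a little
(`eq_shift_of_speed_eq`). -/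

/-- `vt`, `vx`, `vxx` are the first time derivative and the first two space derivatives of `v`. -/
structure HasParabolicDerivs (v vt vx vxx : ℝ → ℝ → ℝ) : Prop where
  cont : Continuous fun z : ℝ × ℝ => v z.1 z.2
  time : ∀ t x, HasDerivAt (fun s => v s x) (vt t x) t
  space : ∀ t x, HasDerivAt (v t) (vx t x) x
  space₂ : ∀ t x, HasDerivAt (vx t) (vxx t x) x

namespace HasParabolicDerivs

variable {v vt vx vxx w wt wx wxx : ℝ → ℝ → ℝ}

theorem sub (hv : HasParabolicDerivs v vt vx vxx) (hw : HasParabolicDerivs w wt wx wxx) :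
    HasParabolicDerivs (fun t x => v t x - w t x) (fun t x => vt t x - wt t x)
      (fun t x => vx t x - wx t x) (fun t x => vxx t x - wxx t x) where
  cont := hv.cont.sub hw.cont
  time t x := (hv.time t x).sub (hw.time t x)
  space t x := (hv.space t x).sub (hw.space t x)
  space₂ t x := (hv.space₂ t x).sub (hw.space₂ t x)

theorem const_mul (m : ℝ) (hv : HasParabolicDerivs v vt vx vxx) :
    HasParabolicDerivs (fun t x => m * v t x) (fun t x => m * vt t x)
      (fun t x => m * vx t x) (fun t x => m * vxx t x) where
  cont := hv.cont.const_mul m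
  time t x := (hv.time t x).const_mul m
  space t x := (hv.space t x).const_mul m
  space₂ t x := (hv.space₂ t x).const_mul m

end HasParabolicDerivs

/-- The second derivative is nonnegative at a local minimum. -/
theorem second_deriv_nonneg_of_isLocalMin {h h' : ℝ → ℝ} {x d : ℝ}
    (hh : ∀ y, HasDerivAt h (h' y) y) (hd : HasDerivAt h' d x) (hmin : IsLocalMin h x) :
    0 ≤ d := by
  by_contra hneg
  push Not at hneg
  have hderiv : deriv h = h' := funext fun y => (hh y).deriv
  have hmax : IsLocalMax h x := by
    refine isLocalMax_of_deriv_deriv_neg ?_ ?_ (hh x).continuousAt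
    · rw [hderiv, hd.deriv]; exact hneg
    · exact hmin.deriv_eq_zero
  have hconst : h =ᶠ[𝓝 x] fun _ => h x := by
    filter_upwards [hmin, hmax] with y h1 h2 using le_antisymm h2 h1
  have h0 : h' =ᶠ[𝓝 x] fun _ => 0 := by
    rw [← hderiv]
    simpa using hconst.deriv
  have h1 := hd.congr_of_eventuallyEq h0.symm
  have := h1.unique (hasDerivAt_const x (0 : ℝ))
  linarith

/-- A slanted strip over a bounded time interval is compact. -/
theorem isCompact_strip (t₀ T s α β : ℝ) :
    IsCompact {p : ℝ × ℝ | p.1 ∈ Set.Icc t₀ T ∧ p.2 - s * p.1 ∈ Set.Icc α β} := by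
  have hc : Continuous fun p : ℝ × ℝ => (p.1, p.2 + s * p.1) := by fun_prop
  convert ((isCompact_Icc (a := t₀) (b := T)).prod (isCompact_Icc (a := α) (b := β))).image hc
    using 1
  ext ⟨t, x⟩
  simp only [Set.mem_ofPred_eq, Set.mem_image, Set.mem_prod, Prod.mk.injEq, Prod.exists]
  constructor
  · rintro ⟨h1, h2⟩
    exact ⟨t, x - s * t, ⟨h1, h2⟩, rfl, by ring⟩
  · rintro ⟨t', y, ⟨h1, h2⟩, rfl, rfl⟩
    exact ⟨h1, by simpa using h2⟩

/-- Minimum principle on a compact slanted strip. -/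
theorem HasParabolicDerivs.nonneg_on_strip {v vt vx vxx : ℝ → ℝ → ℝ}
    (hv : HasParabolicDerivs v vt vx vxx) {t₀ T s α β Λ : ℝ}
    (h₀ : ∀ x, x - s * t₀ ∈ Set.Icc α β → 0 ≤ v t₀ x)
    (hα : ∀ t ∈ Set.Icc t₀ T, 0 ≤ v t (α + s * t))
    (hβ : ∀ t ∈ Set.Icc t₀ T, 0 ≤ v t (β + s * t))
    (hint : ∀ t ∈ Set.Ioc t₀ T, ∀ x, x - s * t ∈ Set.Ioo α β → v t x < 0 →
      vx t x = 0 → 0 ≤ vxx t x → Λ * v t x < vt t x)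
    {t x : ℝ} (ht : t ∈ Set.Icc t₀ T) (hx : x - s * t ∈ Set.Icc α β) : 0 ≤ v t x := by
  by_contra hneg
  push Not at hneg
  set K := {p : ℝ × ℝ | p.1 ∈ Set.Icc t₀ T ∧ p.2 - s * p.1 ∈ Set.Icc α β}
  -- The weight turns the strict bound `Λ * v < vt` into a positive time derivative of the minimized
  -- function.
  have hcont : Continuous fun p : ℝ × ℝ => Real.exp (-Λ * p.1) * v p.1 p.2 := by
    have := hv.cont
    fun_prop
  obtain ⟨⟨t₁, x₁⟩, ⟨ht₁, hx₁⟩, hmin⟩ :=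
    (isCompact_strip t₀ T s α β).exists_isMinOn ⟨(t, x), ht, hx⟩ hcont.continuousOn
  have hmin' : ∀ t' x', t' ∈ Set.Icc t₀ T → x' - s * t' ∈ Set.Icc α β →
      Real.exp (-Λ * t₁) * v t₁ x₁ ≤ Real.exp (-Λ * t') * v t' x' :=
    fun t' x' h1 h2 => hmin (show (t', x') ∈ K from ⟨h1, h2⟩)
  simp only at ht₁ hx₁
  have hv₁ : v t₁ x₁ < 0 := by
    have h1 := hmin' t x ht hx
    have h2 : Real.exp (-Λ * t) * v t x < 0 := mul_neg_of_pos_of_neg (Real.exp_pos _) hneg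
    by_contra h3
    push Not at h3
    have := mul_nonneg (Real.exp_pos (-Λ * t₁)).le h3
    linarith
  have ht₁' : t₀ < t₁ := by
    rcases ht₁.1.lt_or_eq with h | h
    · exact h
    · subst h; linarith [h₀ x₁ hx₁]
  have hx₁' : x₁ - s * t₁ ∈ Set.Ioo α β := by
    refine ⟨lt_of_le_of_ne hx₁.1 fun h => ?_, lt_of_le_of_ne hx₁.2 fun h => ?_⟩
    · have := hα t₁ ht₁
      rw [show α + s * t₁ = x₁ by linarith] at this
      linarith
    · have := hβ t₁ ht₁
      rw [show β + s * t₁ = x₁ by linarith] at this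
      linarith
  have hopen : ∀ᶠ y in 𝓝 x₁, y - s * t₁ ∈ Set.Ioo α β :=
    ContinuousAt.eventually_mem (by fun_prop) (isOpen_Ioo.mem_nhds hx₁')
  have hlocmin : IsLocalMin (v t₁) x₁ := by
    filter_upwards [hopen] with y hy
    exact le_of_mul_le_mul_left (hmin' t₁ y ht₁ (Set.Ioo_subset_Icc_self hy)) (Real.exp_pos _)
  have hx0 : vx t₁ x₁ = 0 := hlocmin.hasDerivAt_eq_zero (hv.space t₁ x₁)
  have hxx : 0 ≤ vxx t₁ x₁ :=
    second_deriv_nonneg_of_isLocalMin (hv.space t₁) (hv.space₂ t₁ x₁) hlocmin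
  have hkey := hint t₁ ⟨ht₁', ht₁.2⟩ x₁ hx₁' hv₁ hx0 hxx
  have hder : HasDerivAt (fun r => Real.exp (-Λ * r) * v r x₁)
      (Real.exp (-Λ * t₁) * (vt t₁ x₁ - Λ * v t₁ x₁)) t₁ := by
    have h1 : HasDerivAt (fun r => Real.exp (-Λ * r)) (Real.exp (-Λ * t₁) * (-Λ * 1)) t₁ :=
      ((hasDerivAt_id t₁).const_mul (-Λ)).exp
    exact (h1.mul (hv.time t₁ x₁)).congr_deriv (by ring)
  have hpos : 0 < Real.exp (-Λ * t₁) * (vt t₁ x₁ - Λ * v t₁ x₁) :=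
    mul_pos (Real.exp_pos _) (by linarith)
  -- Only earlier times are compared, because the minimum may sit at `t₁ = T`. As `x₁` is strictly
  -- inside the strip at time `t₁`, a short step back in time at fixed `x₁` stays in it.
  have hslope := hder.tendsto_slope.mono_left
    (nhdsWithin_mono t₁ (show Set.Iio t₁ ⊆ {t₁}ᶜ from fun y hy => ne_of_lt hy))
  have hev1 := hslope.eventually (lt_mem_nhds hpos)
  have hev2 : ∀ᶠ r in 𝓝[<] t₁, x₁ - s * r ∈ Set.Ioo α β :=
    (ContinuousAt.eventually_mem (f := fun r => x₁ - s * r) (by fun_prop)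
      (isOpen_Ioo.mem_nhds hx₁')).filter_mono nhdsWithin_le_nhds
  have hev3 : ∀ᶠ r in 𝓝[<] t₁, t₀ < r := (lt_mem_nhds ht₁').filter_mono nhdsWithin_le_nhds
  have hev4 : ∀ᶠ r in 𝓝[<] t₁, r < t₁ := self_mem_nhdsWithin
  obtain ⟨r, h1, h2, h3, h4⟩ := (hev1.and (hev2.and (hev3.and hev4))).exists
  have h5 := hmin' r x₁ ⟨h3.le, h4.le.trans ht₁.2⟩ (Set.Ioo_subset_Icc_self h2)
  rw [slope_def_field] at h1
  have h6 := div_nonpos_of_nonneg_of_nonpos (sub_nonneg.2 h5) (sub_nonpos.2 h4.le)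
  linarith

/-- The barrier `(ρ² - y²)²` is a strict subsolution once damped strongly enough in time. -/
theorem barrier_pos {a a₀ A b B ρ N y : ℝ} (ha₀ : 0 < a₀) (ha : a₀ ≤ a) (hA : a ≤ A)
    (hb : |b| ≤ B) (hρ : 0 < ρ) (hN : B ^ 2 / a₀ + 4 * A / ρ ^ 2 < N) (hy : |y| < ρ) :
    0 < a * (8 * y ^ 2 - 4 * (ρ ^ 2 - y ^ 2)) + b * (-4 * y * (ρ ^ 2 - y ^ 2))
      + N * (ρ ^ 2 - y ^ 2) ^ 2 := by
  have hp : 0 < ρ ^ 2 - y ^ 2 := by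
    have := sq_lt_sq' (by linarith [(abs_lt.1 hy).1]) (abs_lt.1 hy).2
    linarith
  set p := ρ ^ 2 - y ^ 2 with hpdef
  have hb2 : b ^ 2 ≤ B ^ 2 := sq_le_sq' (abs_le.1 hb).1 (abs_le.1 hb).2
  -- The term `8 * a * y ^ 2` is split in two: one half completes a square with the drift, the other
  -- (`hdiff`) with `-4 * a * p`. Each square costs a multiple of `p ^ 2`, which `N` pays for.
  have hdrift : 0 ≤ 4 * a₀ * y ^ 2 - 4 * b * y * p + b ^ 2 / a₀ * p ^ 2 := by
    have : 4 * a₀ * y ^ 2 - 4 * b * y * p + b ^ 2 / a₀ * p ^ 2 = (2 * a₀ * y - b * p) ^ 2 / a₀ := by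
      field_simp; ring
    rw [this]; positivity
  have hdiff : 4 * a * y ^ 2 - 4 * a * p + 4 * a / ρ ^ 2 * p ^ 2 = 4 * a * (ρ - p / ρ) ^ 2 := by
    have : y ^ 2 = ρ ^ 2 - p := by rw [hpdef]; ring
    rw [this]; field_simp; ring
  have hdiff' : 0 ≤ 4 * a * (ρ - p / ρ) ^ 2 := by
    have : 0 < a := by linarith
    positivity
  have h1 : b ^ 2 / a₀ + 4 * a / ρ ^ 2 < N := by
    have h2 : b ^ 2 / a₀ ≤ B ^ 2 / a₀ := by gcongr
    have h3 : 4 * a / ρ ^ 2 ≤ 4 * A / ρ ^ 2 := by gcongr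
    linarith
  have h4 : (b ^ 2 / a₀ + 4 * a / ρ ^ 2) * p ^ 2 < N * p ^ 2 := by
    have : 0 < p ^ 2 := by positivity
    gcongr
  have h5 : a₀ * y ^ 2 ≤ a * y ^ 2 := by gcongr
  nlinarith

/-- The damped barrier moving along a line. -/
theorem hasParabolicDerivs_barrier (ε Λ ρ s t₀ x₀ : ℝ) :
    HasParabolicDerivs
      (fun t x => ε * Real.exp (-Λ * (t - t₀)) * (ρ ^ 2 - (x - s * t - x₀) ^ 2) ^ 2)
      (fun t x => ε * Real.exp (-Λ * (t - t₀)) * (-Λ * (ρ ^ 2 - (x - s * t - x₀) ^ 2) ^ 2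
        - s * (-4 * (x - s * t - x₀) * (ρ ^ 2 - (x - s * t - x₀) ^ 2))))
      (fun t x => ε * Real.exp (-Λ * (t - t₀)) *
        (-4 * (x - s * t - x₀) * (ρ ^ 2 - (x - s * t - x₀) ^ 2)))
      (fun t x => ε * Real.exp (-Λ * (t - t₀)) *
        (8 * (x - s * t - x₀) ^ 2 - 4 * (ρ ^ 2 - (x - s * t - x₀) ^ 2))) where
  cont := by fun_prop
  time t x := by
    have h1 : HasDerivAt (fun r => Real.exp (-Λ * (r - t₀)))
        (Real.exp (-Λ * (t - t₀)) * (-Λ * 1)) t :=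
      (((hasDerivAt_id t).sub_const t₀).const_mul (-Λ)).exp
    have h2 : HasDerivAt (fun r => x - s * r - x₀) (-(s * 1)) t :=
      (((hasDerivAt_id t).const_mul s).const_sub x).sub_const x₀
    refine ((h1.const_mul ε).mul (((h2.pow 2).const_sub (ρ ^ 2)).pow 2)).congr_deriv ?_
    simp
    ring
  space t x := by
    have h2 : HasDerivAt (fun y => y - s * t - x₀) 1 x :=
      ((hasDerivAt_id x).sub_const (s * t)).sub_const x₀
    refine ((((h2.pow 2).const_sub (ρ ^ 2)).pow 2).const_mul
      (ε * Real.exp (-Λ * (t - t₀)))).congr_deriv ?_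
    congr 1
    simp
    ring
  space₂ t x := by
    have h2 : HasDerivAt (fun y => y - s * t - x₀) 1 x :=
      ((hasDerivAt_id x).sub_const (s * t)).sub_const x₀
    refine (((h2.const_mul (-4)).mul ((h2.pow 2).const_sub (ρ ^ 2))).const_mul
      (ε * Real.exp (-Λ * (t - t₀)))).congr_deriv ?_
    congr 1
    simp
    ring

/-- Strong maximum principle: positivity of a nonnegative supersolution propagates along a
slanted tube. -/
theorem HasParabolicDerivs.pos_of_tube {v vt vx vxx : ℝ → ℝ → ℝ}
    (hv : HasParabolicDerivs v vt vx vxx) {a a' : ℝ → ℝ} (ha : Continuous a)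
    (ha' : Continuous a') (ha_pos : ∀ x, 0 < a x) {t₀ T s x₀ ρ M : ℝ} (hT : t₀ ≤ T)
    (hρ : 0 < ρ)
    (hnonneg : ∀ t ∈ Set.Icc t₀ T, ∀ x, |x - s * t - x₀| ≤ ρ → 0 ≤ v t x)
    (hsup : ∀ t ∈ Set.Icc t₀ T, ∀ x, |x - s * t - x₀| ≤ ρ →
      a x * vxx t x + a' x * vx t x - M * v t x ≤ vt t x)
    (hpos : 0 < v t₀ (x₀ + s * t₀)) : 0 < v T (x₀ + s * T) := by
  obtain ⟨r, hr, hrpos⟩ : ∃ r > 0, ∀ y, |y - (x₀ + s * t₀)| < r → 0 < v t₀ y := by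
    have hc : ContinuousAt (v t₀) (x₀ + s * t₀) := (hv.space t₀ _).continuousAt
    obtain ⟨r, hr, h⟩ := Metric.eventually_nhds_iff.1 (hc.eventually (lt_mem_nhds hpos))
    exact ⟨r, hr, fun y hy => h (by rwa [Real.dist_eq])⟩
  obtain ⟨R, hR, hRρ, hRr⟩ : ∃ R > 0, R ≤ ρ ∧ R < r :=
    ⟨min ρ (r / 2), by positivity, min_le_left _ _, (min_le_right _ _).trans_lt (by linarith)⟩
  set K := {p : ℝ × ℝ | p.1 ∈ Set.Icc t₀ T ∧ p.2 - s * p.1 ∈ Set.Icc (x₀ - R) (x₀ + R)} with hK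
  have hKc : IsCompact K := isCompact_strip t₀ T s (x₀ - R) (x₀ + R)
  have hmem : ∀ {x t : ℝ}, x - s * t ∈ Set.Icc (x₀ - R) (x₀ + R) ↔ |x - s * t - x₀| ≤ R := by
    intro x t
    rw [abs_le, Set.mem_Icc]
    constructor <;> rintro ⟨h1, h2⟩ <;> constructor <;> linarith
  have hKne : (t₀, x₀ + s * t₀) ∈ K := ⟨⟨le_rfl, hT⟩, hmem.2 (by simp [hR.le])⟩
  obtain ⟨pm, -, hpm⟩ := hKc.exists_isMinOn ⟨_, hKne⟩
    (f := fun p : ℝ × ℝ => a p.2) (by fun_prop)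
  obtain ⟨pM, -, hpM⟩ := hKc.exists_isMaxOn ⟨_, hKne⟩
    (f := fun p : ℝ × ℝ => a p.2) (by fun_prop)
  obtain ⟨pB, -, hpB⟩ := hKc.exists_isMaxOn ⟨_, hKne⟩
    (f := fun p : ℝ × ℝ => |a' p.2 + s|) (by fun_prop)
  obtain ⟨pv, hpvK, hpv⟩ := (isCompact_Icc (a := x₀ + s * t₀ - R)
    (b := x₀ + s * t₀ + R)).exists_isMinOn (Set.nonempty_Icc.2 (by linarith)) (f := v t₀)
    (fun y _ => (hv.space t₀ y).continuousAt.continuousWithinAt)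
  have hv₀ : 0 < v t₀ pv :=
    hrpos pv (abs_lt.2 ⟨by linarith [hpvK.1], by linarith [hpvK.2]⟩)
  -- `|M|` absorbs the zeroth-order term, the bracket is the threshold of `barrier_pos` with drift
  -- `a' + s` in the moving frame, and `1` makes it strict. Below, `ε` puts the barrier under `v` at
  -- time `t₀`.
  set Λ := |M| + (|a' pB.2 + s| ^ 2 / a pm.2 + 4 * a pM.2 / R ^ 2) + 1 with hΛ
  set ε := v t₀ pv / R ^ 4 with hε
  have hεpos : 0 < ε := div_pos hv₀ (by positivity)
  have hz := hv.sub (hasParabolicDerivs_barrier ε Λ R s t₀ x₀)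
  have hge := hz.nonneg_on_strip (t₀ := t₀) (T := T) (s := s) (α := x₀ - R) (β := x₀ + R)
    (Λ := 0) ?_ ?_ ?_ ?_ (t := T) (x := x₀ + s * T) ⟨hT, le_rfl⟩ (hmem.2 (by simp [hR.le]))
  · have h1 : 0 < ε * Real.exp (-Λ * (T - t₀)) * (R ^ 2 - (x₀ + s * T - s * T - x₀) ^ 2) ^ 2 := by
      have : R ^ 2 - (x₀ + s * T - s * T - x₀) ^ 2 = R ^ 2 := by ring
      rw [this]; positivity
    linarith
  · intro x hx
    have h1 : v t₀ pv ≤ v t₀ x := hpv (show x ∈ Set.Icc _ _ from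
      ⟨by linarith [hx.1], by linarith [hx.2]⟩)
    have h2 : (R ^ 2 - (x - s * t₀ - x₀) ^ 2) ^ 2 ≤ R ^ 4 := by
      have h3 : (x - s * t₀ - x₀) ^ 2 ≤ R ^ 2 := sq_le_sq' (by linarith [hx.1]) (by linarith [hx.2])
      have h4 := sq_nonneg (x - s * t₀ - x₀)
      nlinarith
    have h3 : ε * (R ^ 2 - (x - s * t₀ - x₀) ^ 2) ^ 2 ≤ v t₀ pv := by
      calc _ ≤ ε * R ^ 4 := by gcongr
        _ = v t₀ pv := by rw [hε]; field_simp
    simp only [sub_self, mul_zero, Real.exp_zero, mul_one]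
    linarith
  · intro t ht
    have := hnonneg t ht (x₀ - R + s * t) (by
      rw [show x₀ - R + s * t - s * t - x₀ = -R by ring, abs_neg, abs_of_pos hR]; exact hRρ)
    have h2 : R ^ 2 - (x₀ - R + s * t - s * t - x₀) ^ 2 = 0 := by ring
    rw [h2]; simpa using this
  · intro t ht
    have := hnonneg t ht (x₀ + R + s * t) (by
      rw [show x₀ + R + s * t - s * t - x₀ = R by ring, abs_of_pos hR]; exact hRρ)
    have h2 : R ^ 2 - (x₀ + R + s * t - s * t - x₀) ^ 2 = 0 := by ring
    rw [h2]; simpa using this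
  · intro t ht x hx hneg hx0 hxx0
    have htI : t ∈ Set.Icc t₀ T := Set.Ioc_subset_Icc_self ht
    have hxI := Set.Ioo_subset_Icc_self hx
    have hxR := hmem.1 hxI
    have hpK : (t, x) ∈ K := ⟨htI, hxI⟩
    have h1 : a pm.2 ≤ a x := hpm hpK
    have h2 : a x ≤ a pM.2 := hpM hpK
    have h3 : |a' x + s| ≤ |a' pB.2 + s| := hpB hpK
    have hv1 := hnonneg t htI x (hxR.trans hRρ)
    have hs1 := hsup t htI x (hxR.trans hRρ)
    have hyR : |x - s * t - x₀| < R := abs_lt.2 ⟨by linarith [hx.1], by linarith [hx.2]⟩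
    have hbar := barrier_pos (N := Λ - |M|) (ha_pos pm.2) h1 h2 h3 hR (by rw [hΛ]; linarith) hyR
    generalize x - s * t - x₀ = y at *
    have hE : 0 < ε * Real.exp (-Λ * (t - t₀)) := by positivity
    generalize ε * Real.exp (-Λ * (t - t₀)) = E at *
    have hMv : M * v t x ≤ |M| * (E * (R ^ 2 - y ^ 2) ^ 2) :=
      calc M * v t x ≤ |M| * v t x := by gcongr; exact le_abs_self M
        _ ≤ _ := by gcongr; linarith
    have hxx1 : a x * (E * (8 * y ^ 2 - 4 * (R ^ 2 - y ^ 2))) ≤ a x * vxx t x :=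
      mul_le_mul_of_nonneg_left (by linarith) (ha_pos x).le
    have hx1 : vx t x = E * (-4 * y * (R ^ 2 - y ^ 2)) := by linarith
    rw [hx1] at hs1
    have := mul_pos hE hbar
    rw [zero_mul]
    linarith

end PeriodicRD

namespace PeriodicRD

/-! ### Solutions of the equation -/

variable {L c : ℝ} {a : ℝ → ℝ} {f : ℝ → ℝ → ℝ} {r q : ℝ → ℝ} {u : ℝ → ℝ → ℝ}

theorem deriv_flux {h : ℝ → ℝ} {x : ℝ} (ha : DifferentiableAt ℝ a x)
    (hh : DifferentiableAt ℝ (deriv h) x) :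
    deriv (fun y => a y * deriv h y) x = a x * deriv (deriv h) x + deriv a x * deriv h x := by
  have := (ha.hasDerivAt.mul hh.hasDerivAt).deriv
  rw [show (fun y => a y * deriv h y) = a * deriv h from rfl, this]
  ring

theorem IsEntireSolution.hasParabolicDerivs (ha : ContDiff ℝ 2 a) (hu : IsEntireSolution a f u) :
    HasParabolicDerivs u
      (fun t x => a x * deriv (deriv (u t)) x + deriv a x * deriv (u t) x + f x (u t x))
      (fun t x => deriv (u t) x) (fun t x => deriv (deriv (u t)) x) where
  cont := hu.cont
  time t x := by
    have h := (hu.diff_t x t).hasDerivAt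
    rwa [hu.eqn t x, deriv_flux ((ha.differentiable (by norm_num)) x) (hu.diff_xx t x)] at h
  space t x := (hu.diff_x t x).hasDerivAt
  space₂ t x := (hu.diff_xx t x).hasDerivAt

theorem hasParabolicDerivs_of_contDiff {φ : ℝ → ℝ} (hφ : ContDiff ℝ 2 φ) :
    HasParabolicDerivs (fun _ x => φ x) (fun _ _ => 0) (fun _ x => deriv φ x)
      (fun _ x => deriv (deriv φ) x) where
  cont := hφ.continuous.comp continuous_snd
  time t x := hasDerivAt_const t (φ x)
  space t x := (hφ.differentiable (by norm_num) x).hasDerivAt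
  space₂ t x := by
    have h : ContDiff ℝ (1 + 1) φ := by simpa [one_add_one_eq_two] using hφ
    exact ((contDiff_succ_iff_deriv.1 h).2.2.differentiable (by norm_num) x).hasDerivAt

theorem IsEntireSolution.shift (hu : IsEntireSolution a f u) (s : ℝ) :
    IsEntireSolution a f (fun t x => u (t + s) x) where
  cont := hu.cont.comp (by fun_prop : Continuous fun z : ℝ × ℝ => (z.1 + s, z.2))
  diff_t x := (hu.diff_t x).comp (by fun_prop : Differentiable ℝ fun t : ℝ => t + s)
  diff_x t := hu.diff_x (t + s)
  diff_xx t := hu.diff_xx (t + s)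
  cont_t := by
    have := hu.cont_t.comp (by fun_prop : Continuous fun z : ℝ × ℝ => (z.1 + s, z.2))
    refine this.congr fun z => ?_
    exact (deriv_comp_add_const (fun r => u r z.2) s z.1).symm
  cont_x := hu.cont_x.comp (by fun_prop : Continuous fun z : ℝ × ℝ => (z.1 + s, z.2))
  cont_xx := hu.cont_xx.comp (by fun_prop : Continuous fun z : ℝ × ℝ => (z.1 + s, z.2))
  eqn t x := by
    rw [deriv_comp_add_const (fun r => u r x) s t]
    exact hu.eqn (t + s) x

theorem IsPulsatingWave.shift (hu : IsPulsatingWave L a f c r q u) (s : ℝ) :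
    IsPulsatingWave L a f c r q (fun t x => u (t + s) x) where
  right_state := hu.right_state
  left_state := hu.left_state
  solution := hu.solution.shift s
  profile := by
    obtain ⟨P, h1, h2, h3, h4⟩ := hu.profile
    refine ⟨fun z => P (z - c * s), fun z => h1 _, fun t x => ?_, ?_, ?_⟩
    · rw [h2]; congr 1; ring
    · exact fun U hU =>
        (tendsto_atBot_add_const_right atBot (-(c * s)) tendsto_id).eventually (h3 U hU)
    · exact fun U hU =>
        (tendsto_atTop_add_const_right atTop (-(c * s)) tendsto_id).eventually (h4 U hU)

theorem Steeper.shift {u₁ u₂ : ℝ → ℝ → ℝ} (h : Steeper u₁ u₂) (s : ℝ) :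
    Steeper (fun t x => u₁ (t + s) x) u₂ :=
  fun x₁ t₁ t₂ he => h x₁ (t₁ + s) t₂ he

/-- If `u₁ ≤ u₂` at a point, the same holds to the right of that point. -/
theorem Steeper.le_right {u₁ u₂ : ℝ → ℝ → ℝ} (h : Steeper u₁ u₂)
    {t x₀ x : ℝ} (hc₁ : Continuous (u₁ t)) (hc₂ : Continuous (u₂ t))
    (h₀ : u₁ t x₀ ≤ u₂ t x₀) (hx : x₀ ≤ x) : u₁ t x ≤ u₂ t x := by
  by_contra hlt
  push Not at hlt
  obtain ⟨y, hy, hy0⟩ := intermediate_value_Icc hx (hc₁.sub hc₂).continuousOn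
    (show (0 : ℝ) ∈ Set.Icc (u₁ t x₀ - u₂ t x₀) (u₁ t x - u₂ t x) from
      ⟨by linarith, by linarith⟩)
  have := (h y t t (sub_eq_zero.1 hy0)).2 x hy.2
  linarith

theorem IsPulsatingWave.near_left (hu : IsPulsatingWave L a f c r q u) {ε : ℝ} (hε : 0 < ε) :
    ∃ K, ∀ t x, x - c * t ≤ K → |u t x - q x| < ε := by
  obtain ⟨P, h1, h2, h3, h4⟩ := hu.profile
  obtain ⟨K, hK⟩ := eventually_atBot.1 (Metric.tendstoUniformly_iff.1 h3 ε hε)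
  refine ⟨K, fun t x hx => ?_⟩
  have := hK _ hx x
  rwa [dist_comm, Real.dist_eq, ← h2] at this

theorem IsPulsatingWave.near_right (hu : IsPulsatingWave L a f c r q u) {ε : ℝ} (hε : 0 < ε) :
    ∃ K, ∀ t x, K ≤ x - c * t → |u t x - r x| < ε := by
  obtain ⟨P, h1, h2, h3, h4⟩ := hu.profile
  obtain ⟨K, hK⟩ := eventually_atTop.1 (Metric.tendstoUniformly_iff.1 h4 ε hε)
  refine ⟨K, fun t x hx => ?_⟩
  have := hK _ hx x
  rwa [dist_comm, Real.dist_eq, ← h2] at this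

/-- A pulsating wave with nonzero speed is invariant under the space-time shifts `(nL/c, nL)`. -/
theorem IsPulsatingWave.shift_period (hu : IsPulsatingWave L a f c r q u) (hc : c ≠ 0) (n : ℤ)
    (t x : ℝ) : u (t + n * (L / c)) (x + n * L) = u t x := by
  obtain ⟨P, h1, h2, -, -⟩ := hu.profile
  rw [h2, h2, show x + n * L - c * (t + n * (L / c)) = x - c * t by field_simp; ring]
  exact (h1 _).int_mul n x

/-- A positive continuous periodic function is bounded below by a positive constant. -/
theorem exists_pos_le_of_periodic {h : ℝ → ℝ} (hL : 0 < L) (hc : Continuous h)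
    (hp : Function.Periodic h L) (hpos : ∀ x, 0 < h x) : ∃ η > 0, ∀ x, η ≤ h x := by
  obtain ⟨y, -, hy⟩ := (isCompact_Icc (a := (0 : ℝ)) (b := L)).exists_isMinOn
    (Set.nonempty_Icc.2 hL.le) hc.continuousOn
  refine ⟨h y, hpos y, fun x => ?_⟩
  obtain ⟨z, hz, hxz⟩ := hp.exists_mem_Ico₀ hL x
  rw [hxz]
  exact hy (Set.Ico_subset_Icc_self hz)

/-- The reaction term is Lipschitz in `u` along two continuous functions on a compact set. -/
theorem exists_lipschitz_on_compact (hf : ContDiff ℝ 1 fun z : ℝ × ℝ => f z.1 z.2)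
    {u₁ u₂ : ℝ → ℝ → ℝ} (h₁ : Continuous fun z : ℝ × ℝ => u₁ z.1 z.2)
    (h₂ : Continuous fun z : ℝ × ℝ => u₂ z.1 z.2) {K : Set (ℝ × ℝ)} (hK : IsCompact K) :
    ∃ M, 0 ≤ M ∧ ∀ t x, (t, x) ∈ K →
      |f x (u₁ t x) - f x (u₂ t x)| ≤ M * |u₁ t x - u₂ t x| := by
  obtain ⟨R₁, hR₁⟩ := (hK.image (f := fun z : ℝ × ℝ => (z.2, u₁ z.1 z.2))
    (by fun_prop)).isBounded.subset_closedBall 0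
  obtain ⟨R₂, hR₂⟩ := (hK.image (f := fun z : ℝ × ℝ => (z.2, u₂ z.1 z.2))
    (by fun_prop)).isBounded.subset_closedBall 0
  set S := Metric.closedBall (0 : ℝ × ℝ) (max R₁ R₂)
  obtain ⟨M, hM⟩ := ((isCompact_closedBall (0 : ℝ × ℝ) (max R₁ R₂)).image
    (hf.continuous_fderiv (by norm_num)).norm).isBounded.subset_closedBall 0
  refine ⟨|M|, abs_nonneg M, fun t x hp => ?_⟩
  have hp₁ : (x, u₁ t x) ∈ S := Metric.closedBall_subset_closedBall (le_max_left _ _)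
    (hR₁ ⟨(t, x), hp, rfl⟩)
  have hp₂ : (x, u₂ t x) ∈ S := Metric.closedBall_subset_closedBall (le_max_right _ _)
    (hR₂ ⟨(t, x), hp, rfl⟩)
  have h := (convex_closedBall (0 : ℝ × ℝ) (max R₁ R₂)).norm_image_sub_le_of_norm_fderiv_le
    (f := fun z : ℝ × ℝ => f z.1 z.2) (C := |M|) (𝕜 := ℝ)
    (fun z _ => hf.differentiable (by norm_num) z)
    (fun z hz => by
      have := hM ⟨z, hz, rfl⟩
      simp only [Metric.mem_closedBall, dist_zero_right, norm_norm] at this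
      exact this.trans (le_abs_self M)) hp₂ hp₁
  simpa [Prod.norm_def] using h

/-- Strong comparison principle: two ordered solutions that differ at one point are strictly
ordered at all later times. -/
theorem IsEntireSolution.lt_of_le_of_lt {u₁ u₂ : ℝ → ℝ → ℝ} (ha : ContDiff ℝ 2 a)
    (ha_pos : ∀ x, 0 < a x) (hf : ContDiff ℝ 1 fun z : ℝ × ℝ => f z.1 z.2)
    (h₁ : IsEntireSolution a f u₁) (h₂ : IsEntireSolution a f u₂) {t₀ T x₀ x₁ : ℝ} (hT : t₀ < T)
    (hle : ∀ t ∈ Set.Icc t₀ T, ∀ x, u₁ t x ≤ u₂ t x) (hlt : u₁ t₀ x₀ < u₂ t₀ x₀) :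
    u₁ T x₁ < u₂ T x₁ := by
  -- With this slope the axis of the tube joins `(t₀, x₀)` to `(T, x₁)`.
  set s := (x₁ - x₀) / (T - t₀) with hs
  have hsT : s * (T - t₀) = x₁ - x₀ := by
    rw [hs]; field_simp [(sub_pos.2 hT).ne']
  set ξ := x₀ - s * t₀ with hξ
  obtain ⟨M, hM0, hM⟩ := exists_lipschitz_on_compact hf h₁.cont h₂.cont
    (isCompact_strip t₀ T s (ξ - 1) (ξ + 1))
  have hv := (h₂.hasParabolicDerivs ha).sub (h₁.hasParabolicDerivs ha)
  have hstart : ξ + s * t₀ = x₀ := by rw [hξ]; ring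
  have hend : ξ + s * T = x₁ := by rw [hξ]; linarith
  have h := hv.pos_of_tube (a' := deriv a) (x₀ := ξ) (s := s) (ρ := 1) (M := M) ha.continuous
    (ha.continuous_deriv (by norm_num)) ha_pos hT.le one_pos
    (fun t ht x _ => sub_nonneg.2 (hle t ht x)) ?_ (by rw [hstart]; linarith)
  · rw [hend] at h; linarith
  · intro t ht x hx
    have hx' := abs_le.1 hx
    have h1 := hM t x ⟨ht, by constructor <;> simp only <;> linarith⟩
    rw [abs_of_nonpos (sub_nonpos.2 (hle t ht x))] at h1
    have := (abs_le.1 h1).2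
    linarith

end PeriodicRD

namespace PeriodicRD

/-! ### Comparison to the left of a moving line -/

variable {L c δ μ : ℝ} {a g φ : ℝ → ℝ} {f : ℝ → ℝ → ℝ} {q r₁ r₂ : ℝ → ℝ} {u₁ u₂ : ℝ → ℝ → ℝ}

theorem reaction_sub_le (hf : ContDiff ℝ 1 fun z : ℝ × ℝ => f z.1 z.2)
    (hfg : ∀ x, ∀ u ∈ Set.Icc (q x - δ) (q x), deriv (f x) u ≤ g x) {x v w : ℝ}
    (hv : q x - δ ≤ v) (hvw : v ≤ w) (hw : w ≤ q x) : f x w - f x v ≤ g x * (w - v) := by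
  have hd : Differentiable ℝ (f x) :=
    (hf.differentiable (by norm_num)).comp (by fun_prop : Differentiable ℝ fun y : ℝ => (x, y))
  refine (convex_Icc (q x - δ) (q x)).image_sub_le_mul_sub_of_deriv_le
    hd.continuous.continuousOn hd.differentiableOn (fun y hy => hfg x y (interior_subset hy))
    v ⟨hv, hvw.trans hw⟩ w ⟨hv.trans hvw, hw⟩ hvw

/-- The eigenvalue equation in expanded form. -/
theorem eigen_expanded (ha : ContDiff ℝ 2 a) (hφ : ContDiff ℝ 2 φ)
    (heq : ∀ x, deriv (fun y => a y * deriv φ y) x + g x * φ x = μ * φ x) (x : ℝ) :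
    a x * deriv (deriv φ) x + deriv a x * deriv φ x = (μ - g x) * φ x := by
  have h := heq x
  have h2 := (hasParabolicDerivs_of_contDiff hφ).space₂ 0 x
  rw [deriv_flux ((ha.differentiable (by norm_num)) x) h2.differentiableAt] at h
  linarith

/-- The coefficient `g` is recovered from the eigenvalue equation after division by `φ`. Continuity
is needed to bound `g` on compact strips. -/
theorem continuous_of_eigen (ha : ContDiff ℝ 2 a) (hφ : ContDiff ℝ 2 φ) (hφ_pos : ∀ x, 0 < φ x)
    (heq : ∀ x, deriv (fun y => a y * deriv φ y) x + g x * φ x = μ * φ x) : Continuous g := by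
  have hg : g = fun x => μ - (a x * deriv (deriv φ) x + deriv a x * deriv φ x) / φ x := by
    funext x
    rw [eigen_expanded ha hφ heq, mul_div_cancel_right₀ _ (hφ_pos x).ne']
    ring
  have h1 : Continuous (deriv a) := ha.continuous_deriv (by norm_num)
  have h2 : Continuous (deriv φ) := hφ.continuous_deriv (by norm_num)
  have h3 : Continuous (deriv (deriv φ)) := by
    have h : ContDiff ℝ (1 + 1) φ := by simpa [one_add_one_eq_two] using hφ
    exact (contDiff_succ_iff_deriv.1 h).2.2.continuous_deriv (by norm_num)
  rw [hg]
  exact continuous_const.sub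
    (((ha.continuous.mul h3).add (h1.mul h2)).div hφ.continuous fun x => (hφ_pos x).ne')

/-- An ordering on the line `x = c₂ t + K` up to time `T` extends to the left of the line when the
first wave is faster. -/
theorem IsPulsatingWave.le_left_of_faster {c₁ c₂ η K T : ℝ} (hL : 0 < L) (ha : ContDiff ℝ 2 a)
    (ha_pos : ∀ x, 0 < a x) (hf : ContDiff ℝ 1 fun z : ℝ × ℝ => f z.1 z.2)
    (h₁ : IsPulsatingWave L a f c₁ r₁ q u₁) (h₂ : IsPulsatingWave L a f c₂ r₂ q u₂)
    (hle : ∀ t x, u₁ t x ≤ q x) (hφ : ContDiff ℝ 2 φ) (hφ_per : Function.Periodic φ L)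
    (hφ_pos : ∀ x, 0 < φ x)
    (heq : ∀ x, deriv (fun y => a y * deriv φ y) x + g x * φ x = μ * φ x) (hμ : μ ≤ 0)
    (hfg : ∀ x, ∀ u ∈ Set.Icc (q x - δ) (q x), deriv (f x) u ≤ g x)
    (hη : 0 < η) (hgap : ∀ x, η ≤ q x - r₁ x) (hc : c₂ < c₁)
    (hKδ : ∀ t x, x - c₂ * t ≤ K → q x - δ ≤ u₂ t x)
    (hKη : ∀ t x, x - c₂ * t ≤ K → q x - η / 2 ≤ u₂ t x)
    (hline : ∀ t ≤ T, u₁ t (K + c₂ * t) ≤ u₂ t (K + c₂ * t)) {t x : ℝ} (ht : t ≤ T)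
    (hx : x - c₂ * t ≤ K) : u₁ t x ≤ u₂ t x := by
  suffices H : ∀ ε > 0, u₁ t x - u₂ t x ≤ ε * φ x by
    by_contra hlt
    push Not at hlt
    have h1 := H ((u₁ t x - u₂ t x) / (2 * φ x))
      (div_pos (by linarith) (by linarith [hφ_pos x]))
    have h2 : (u₁ t x - u₂ t x) / (2 * φ x) * φ x = (u₁ t x - u₂ t x) / 2 := by
      field_simp [(hφ_pos x).ne']
    linarith
  intro ε hε
  obtain ⟨φ₀, hφ₀, hφ_ge⟩ := exists_pos_le_of_periodic hL hφ.continuous hφ_per hφ_pos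
  obtain ⟨K₂, hK₂⟩ := h₂.near_left (mul_pos hε hφ₀)
  obtain ⟨K₁, hK₁⟩ := h₁.near_right (half_pos hη)
  -- Far to the left `u₂` is within `ε * φ₀` of `q`, which lies above `u₁`, so the strip can be cut
  -- off at `α`.
  have hfar : ∀ t x, x - c₂ * t ≤ K₂ → u₁ t x - u₂ t x ≤ ε * φ x := by
    intro t x hx
    have h1 := (abs_lt.1 (hK₂ t x hx)).1
    have h2 := mul_le_mul_of_nonneg_left (hφ_ge x) hε.le
    linarith [hle t x]
  -- So early that `K₁ + c₁ * t₀ ≤ K₂ + c₂ * t₀`: each point is either left of `K₂` in the frame of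
  -- `u₂`, or right of `K₁` in the frame of `u₁`, where `u₁` is near `r₁`.
  set t₀ := min t ((K₂ - K₁) / (c₁ - c₂)) with ht₀
  have ht₀t : t₀ ≤ t := min_le_left _ _
  have ht₀' : (c₁ - c₂) * t₀ ≤ K₂ - K₁ := by
    have h := mul_le_mul_of_nonneg_left (min_le_right t ((K₂ - K₁) / (c₁ - c₂)))
      (sub_pos.2 hc).le
    rwa [mul_div_cancel₀ _ (sub_pos.2 hc).ne'] at h
  set α := min K₂ (x - c₂ * t) with hα
  have hK := isCompact_strip t₀ t c₂ α K
  obtain ⟨pg, -, hpg⟩ := hK.exists_isMaxOn ⟨(t, x), ⟨ht₀t, le_rfl⟩, min_le_right _ _, hx⟩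
    (f := fun p : ℝ × ℝ => g p.2)
    ((continuous_of_eigen ha hφ hφ_pos heq).comp continuous_snd).continuousOn
  have hv := ((hasParabolicDerivs_of_contDiff hφ).const_mul ε).sub
    ((h₁.solution.hasParabolicDerivs ha).sub (h₂.solution.hasParabolicDerivs ha))
  have h := hv.nonneg_on_strip (t₀ := t₀) (T := t) (s := c₂) (α := α) (β := K)
    (Λ := g pg.2 + 1) ?_ ?_ ?_ ?_ (t := t) (x := x) ⟨ht₀t, le_rfl⟩ ⟨min_le_right _ _, hx⟩
  · linarith
  · intro y hy
    rcases le_or_gt K₁ (y - c₁ * t₀) with h | h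
    · have h1 := (abs_lt.1 (hK₁ t₀ y h)).2
      have h2 := hKη t₀ y hy.2
      have h3 := mul_pos hε (hφ_pos y)
      linarith [hgap y]
    · linarith [hfar t₀ y (by linarith)]
  · intro s _
    linarith [hfar s (α + c₂ * s) (by linarith [min_le_left K₂ (x - c₂ * t)])]
  · intro s hs
    have h1 := hline s (hs.2.trans ht)
    have h2 := mul_pos hε (hφ_pos (K + c₂ * s))
    linarith
  -- Where `v < 0`, `u₁` exceeds `u₂`, so both values lie in `[q - δ, q]` and the bound by `g`
  -- applies.
  · intro s hs y hy hneg hx0 hxx0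
    have hpos := mul_pos hε (hφ_pos y)
    have h1 := reaction_sub_le hf hfg (hKδ s y hy.2.le) (w := u₁ s y) (by linarith) (hle s y)
    have h2 : g y ≤ g pg.2 := hpg (show (s, y) ∈ _ from
      ⟨Set.Ioc_subset_Icc_self hs, Set.Ioo_subset_Icc_self hy⟩)
    have h3 := eigen_expanded ha hφ heq y
    have h4 := mul_nonneg (ha_pos y).le hxx0
    have h5 : deriv a y * (ε * deriv φ y - (deriv (u₁ s) y - deriv (u₂ s) y)) = 0 := by
      rw [hx0, mul_zero]
    have h6 : (g pg.2 + 1) * (ε * φ y - (u₁ s y - u₂ s y))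
        < g y * (ε * φ y - (u₁ s y - u₂ s y)) :=
      mul_lt_mul_of_neg_right (by linarith) hneg
    have h7 : μ * (ε * φ y) ≤ 0 := mul_nonpos_of_nonpos_of_nonneg hμ hpos.le
    have h8 := congrArg (ε * ·) h3
    linarith

/-- Brings any time into a prescribed window by whole periods; `p = L / c` may be negative. -/
theorem exists_int_shift {p : ℝ} (hp : p ≠ 0) (t b : ℝ) :
    ∃ n : ℤ, t + n * p ∈ Set.Ico b (b + |p|) := by
  obtain ⟨m, hm, -⟩ := existsUnique_add_zsmul_mem_Ico (abs_pos.2 hp) t b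
  rw [zsmul_eq_mul] at hm
  rcases abs_choice p with h | h <;> rw [h] at hm ⊢
  · exact ⟨m, hm⟩
  · exact ⟨-m, by simpa using hm⟩

/-- For two waves with the same nonzero speed, a strict ordering on a line moving with the waves
extends to the left of the line. -/
theorem IsPulsatingWave.le_left_of_speed_eq {K : ℝ} (hL : 0 < L) (ha : ContDiff ℝ 2 a)
    (ha_pos : ∀ x, 0 < a x) (hf : ContDiff ℝ 1 fun z : ℝ × ℝ => f z.1 z.2)
    (h₁ : IsPulsatingWave L a f c r₁ q u₁) (h₂ : IsPulsatingWave L a f c r₂ q u₂)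
    (hle : ∀ t x, u₁ t x ≤ q x) (hφ : ContDiff ℝ 2 φ) (hφ_per : Function.Periodic φ L)
    (hφ_pos : ∀ x, 0 < φ x)
    (heq : ∀ x, deriv (fun y => a y * deriv φ y) x + g x * φ x = μ * φ x) (hμ : μ ≤ 0)
    (hfg : ∀ x, ∀ u ∈ Set.Icc (q x - δ) (q x), deriv (f x) u ≤ g x) (hc : c ≠ 0)
    (hKδ : ∀ t x, x - c * t ≤ K → q x - δ ≤ u₂ t x)
    (hline : ∀ t, u₁ t (K + c * t) < u₂ t (K + c * t)) {t x : ℝ}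
    (hx : x - c * t ≤ K) : u₁ t x ≤ u₂ t x := by
  by_contra hlt
  push Not at hlt
  have hp : L / c ≠ 0 := div_ne_zero hL.ne' hc
  obtain ⟨φ₀, hφ₀, hφ_ge⟩ := exists_pos_le_of_periodic hL hφ.continuous hφ_per hφ_pos
  set m₀ := (u₁ t x - u₂ t x) / φ x with hm₀
  have hm₀pos : 0 < m₀ := div_pos (by linarith) (hφ_pos x)
  obtain ⟨K₂, hK₂⟩ := h₂.near_left (mul_pos hm₀pos hφ₀)
  set ratio : ℝ × ℝ → ℝ := fun p => (u₁ p.1 p.2 - u₂ p.1 p.2) / φ p.2 with hratio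
  have hratio_per : ∀ (n : ℤ) t x, ratio (t + n * (L / c), x + n * L) = ratio (t, x) := by
    intro n t x
    simp only [hratio]
    rw [h₁.shift_period hc, h₂.shift_period hc, hφ_per.int_mul n x]
  have hratio_cont : Continuous ratio :=
    (h₁.solution.cont.sub h₂.solution.cont).div (hφ.continuous.comp continuous_snd)
      fun p => (hφ_pos p.2).ne'
  have hfar : ∀ t x, x - c * t ≤ K₂ → ratio (t, x) < m₀ := by
    intro t x hx
    have h1 := (abs_lt.1 (hK₂ t x hx)).1
    have h2 := mul_le_mul_of_nonneg_left (hφ_ge x) hm₀pos.le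
    exact (div_lt_iff₀ (hφ_pos x)).2 (by linarith [hle t x])
  -- Modulo periods, the points where `ratio` is at least `m₀` lie in a compact strip, so `ratio`
  -- attains its maximum `m` left of the line.
  have hnear : ∀ t x, x - c * t ≤ K → m₀ ≤ ratio (t, x) → ∃ n : ℤ,
      (t + n * (L / c), x + n * L) ∈ {p : ℝ × ℝ | p.1 ∈ Set.Icc 0 |L / c| ∧
        p.2 - c * p.1 ∈ Set.Icc K₂ K} := by
    intro t x hx hm
    obtain ⟨n, hn⟩ := exists_int_shift hp t 0
    refine ⟨n, ⟨hn.1, by simpa using hn.2.le⟩, ?_⟩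
    have h1 : x + n * L - c * (t + n * (L / c)) = x - c * t := by field_simp; ring
    simp only [h1]
    refine ⟨?_, hx⟩
    by_contra h
    push Not at h
    linarith [hfar t x h.le]
  obtain ⟨n, hn⟩ := hnear t x hx le_rfl
  obtain ⟨⟨t₁, x₁⟩, ⟨-, hx₁⟩, hmax⟩ := (isCompact_strip 0 |L / c| c K₂ K).exists_isMaxOn ⟨_, hn⟩
    hratio_cont.continuousOn
  simp only at hx₁
  set m := ratio (t₁, x₁) with hm
  have hm₀m : m₀ ≤ m := by
    have h : ratio (t + n * (L / c), x + n * L) ≤ m := hmax hn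
    rwa [hratio_per] at h
  have hmpos : 0 < m := hm₀pos.trans_le hm₀m
  have hall : ∀ t x, x - c * t ≤ K → u₁ t x - u₂ t x ≤ m * φ x := by
    intro t x hx
    rw [← div_le_iff₀ (hφ_pos x)]
    change ratio (t, x) ≤ m
    rcases lt_or_ge (ratio (t, x)) m₀ with h | h
    · exact h.le.trans hm₀m
    · obtain ⟨k, hk⟩ := hnear t x hx h
      have h' : ratio (t + k * (L / c), x + k * L) ≤ m := hmax hk
      rwa [hratio_per] at h'
  have hzero : m * φ x₁ - (u₁ t₁ x₁ - u₂ t₁ x₁) = 0 := by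
    simp only [hm, hratio]
    rw [div_mul_cancel₀ _ (hφ_pos x₁).ne', sub_self]
  have hx₁lt : x₁ - c * t₁ < K := by
    refine lt_of_le_of_ne hx₁.2 fun h => ?_
    have h1 := hline t₁
    rw [show K + c * t₁ = x₁ by linarith] at h1
    linarith [mul_pos hmpos (hφ_pos x₁)]
  have hv := ((hasParabolicDerivs_of_contDiff hφ).const_mul m).sub
    ((h₁.solution.hasParabolicDerivs ha).sub (h₂.solution.hasParabolicDerivs ha))
  set t₀ := t₁ - 1 with ht₀
  obtain ⟨ρ₀, hρ₀, hρ₀pos⟩ : ∃ ρ₀ > 0, ∀ y, |y - (K + c * t₀)| < ρ₀ →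
      0 < m * φ y - (u₁ t₀ y - u₂ t₀ y) := by
    have hcont : ContinuousAt (fun y => m * φ y - (u₁ t₀ y - u₂ t₀ y)) (K + c * t₀) :=
      (hv.space t₀ _).continuousAt
    have h0 : 0 < m * φ (K + c * t₀) - (u₁ t₀ (K + c * t₀) - u₂ t₀ (K + c * t₀)) := by
      linarith [mul_pos hmpos (hφ_pos (K + c * t₀)), hline t₀]
    obtain ⟨r, hr, h⟩ := Metric.eventually_nhds_iff.1 (hcont.eventually (lt_mem_nhds h0))
    exact ⟨r, hr, fun y hy => h (by rwa [Real.dist_eq])⟩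
  obtain ⟨ρ, hρ, hρρ₀, hρx₁⟩ : ∃ ρ > 0, ρ < ρ₀ ∧ ρ ≤ K + c * t₁ - x₁ :=
    ⟨min (ρ₀ / 2) (K + c * t₁ - x₁), lt_min (by linarith) (by linarith),
      (min_le_left _ _).trans_lt (by linarith), min_le_right _ _⟩
  -- A tube from just left of the line, where `m * φ - (u₁ - u₂)` is positive, to its zero `(t₁,
  -- x₁)`; the strong maximum principle along it gives the contradiction. The time span is `1`, so
  -- the slope is `x₁ - x₀`.
  set x₀ := K + c * t₀ - ρ with hx₀
  set s := x₁ - x₀ with hs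
  set ξ := x₀ - s * t₀ with hξ
  have htube : ∀ t ∈ Set.Icc t₀ t₁, ∀ x, |x - s * t - ξ| ≤ ρ → x - c * t ≤ K := by
    intro t ht x hx
    have h1 := (abs_le.1 hx).2
    -- The distance from the axis to the line is affine in time and at least `ρ` at both ends.
    have h2 : (s - c) * (t - t₀) ≤ 0 ∨ (s - c) * (t - t₁) ≤ 0 := by
      rcases le_total (s - c) 0 with h | h
      · exact Or.inl (mul_nonpos_of_nonpos_of_nonneg h (sub_nonneg.2 ht.1))
      · exact Or.inr (mul_nonpos_of_nonneg_of_nonpos h (sub_nonpos.2 ht.2))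
    have h3 : t₁ = t₀ + 1 := by rw [ht₀]; ring
    rw [h3] at h2 hρx₁
    rcases h2 with h2 | h2
    · linarith
    · linarith
  obtain ⟨M, hM0, hM⟩ := exists_lipschitz_on_compact hf h₁.solution.cont h₂.solution.cont
    (isCompact_strip t₀ t₁ s (ξ - ρ) (ξ + ρ))
  obtain ⟨pg, -, hpg⟩ := (isCompact_strip t₀ t₁ s (ξ - ρ) (ξ + ρ)).exists_isMaxOn
    ⟨(t₀, x₀), ⟨le_rfl, by rw [ht₀]; linarith⟩, by constructor <;> simp only <;> linarith⟩
    (f := fun p : ℝ × ℝ => |g p.2|)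
    ((continuous_of_eigen ha hφ hφ_pos heq).comp continuous_snd).abs.continuousOn
  have hend : ξ + s * t₁ = x₁ := by
    have : t₁ = t₀ + 1 := by rw [ht₀]; ring
    rw [hξ, this, hs]; ring
  have hstart : ξ + s * t₀ = x₀ := by rw [hξ]; ring
  have h := hv.pos_of_tube (a' := deriv a) (t₀ := t₀) (T := t₁) (s := s) (x₀ := ξ) (ρ := ρ)
    (M := M + |g pg.2|) ha.continuous (ha.continuous_deriv (by norm_num)) ha_pos
    (by rw [ht₀]; linarith) hρ
    (fun t ht x hx => by linarith [hall t x (htube t ht x hx)]) ?_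
    (by
      rw [hstart]
      refine hρ₀pos x₀ ?_
      rw [hx₀, show K + c * t₀ - ρ - (K + c * t₀) = -ρ by ring, abs_neg, abs_of_pos hρ]
      exact hρρ₀)
  · rw [hend] at h
    linarith
  · intro t ht x hx
    have hxK := htube t ht x hx
    have hx' := abs_le.1 hx
    have hmem : (t, x) ∈ {p : ℝ × ℝ | p.1 ∈ Set.Icc t₀ t₁ ∧
        p.2 - s * p.1 ∈ Set.Icc (ξ - ρ) (ξ + ρ)} :=
      ⟨ht, by constructor <;> simp only <;> linarith⟩
    have hg : |g x| ≤ |g pg.2| := hpg hmem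
    have hLip := hM t x hmem
    have heig := congrArg (m * ·) (eigen_expanded ha hφ heq x)
    have hmφ : 0 < m * φ x := mul_pos hmpos (hφ_pos x)
    have hv0 : 0 ≤ m * φ x - (u₁ t x - u₂ t x) := by linarith [hall t x hxK]
    have hμ' : μ * (m * φ x) ≤ 0 := mul_nonpos_of_nonpos_of_nonneg hμ hmφ.le
    have hgabs := abs_le.1 hg
    suffices hkey : f x (u₁ t x) - f x (u₂ t x) ≤ g x * (m * φ x)
        + (M + |g pg.2|) * (m * φ x - (u₁ t x - u₂ t x)) by linarith
    -- The bound by `g` needs `u₂ ≤ u₁`; otherwise `u₁` may leave `[q - δ, q]` and the Lipschitz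
    -- bound is used.
    rcases le_total (u₂ t x) (u₁ t x) with hw | hw
    · have h1 := reaction_sub_le hf hfg (hKδ t x hxK) hw (hle t x)
      have h2 : 0 ≤ (M + |g pg.2| + g x) * (m * φ x - (u₁ t x - u₂ t x)) :=
        mul_nonneg (by linarith) hv0
      linarith
    · rw [abs_of_nonpos (sub_nonpos.2 hw)] at hLip
      have h1 := (abs_le.1 hLip).2
      have h2 : 0 ≤ (|g pg.2| + g x) * (m * φ x) := mul_nonneg (by linarith) hmφ.le
      have h3 : 0 ≤ |g pg.2| * (u₂ t x - u₁ t x) := mul_nonneg (abs_nonneg _) (by linarith)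
      have h4 : 0 ≤ M * (m * φ x) := mul_nonneg hM0 hmφ.le
      linarith

end PeriodicRD

/-! ### Sliding arguments: order of the speeds, uniqueness up to a time shift -/

namespace PeriodicRD

variable {L c δ μ : ℝ} {a g φ : ℝ → ℝ} {f : ℝ → ℝ → ℝ} {q r₁ r₂ : ℝ → ℝ} {u₁ u₂ : ℝ → ℝ → ℝ}

/-- A uniform gap between ordered stationary states. -/
theorem IsPulsatingWave.exists_gap {r : ℝ → ℝ} {u : ℝ → ℝ → ℝ} (hL : 0 < L)
    (hu : IsPulsatingWave L a f c r q u) (h : ∀ x, r x < q x) : ∃ η > 0, ∀ x, η ≤ q x - r x :=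
  exists_pos_le_of_periodic hL (hu.left_state.smooth.continuous.sub
    hu.right_state.smooth.continuous) (hu.left_state.periodic.sub hu.right_state.periodic)
    fun x => sub_pos.2 (h x)

/-- The steeper wave is not faster. -/
theorem IsPulsatingWave.speed_le {c₁ c₂ : ℝ} (hL : 0 < L) (ha : ContDiff ℝ 2 a)
    (ha_pos : ∀ x, 0 < a x) (hf : ContDiff ℝ 1 fun z : ℝ × ℝ => f z.1 z.2)
    (h₁ : IsPulsatingWave L a f c₁ r₁ q u₁) (h₂ : IsPulsatingWave L a f c₂ r₂ q u₂)
    (hr₁ : ∀ x, r₁ x < q x) (hr₂ : ∀ x, r₂ x < q x)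
    (hle : ∀ t x, u₁ t x ≤ q x) (hφ : ContDiff ℝ 2 φ) (hφ_per : Function.Periodic φ L)
    (hφ_pos : ∀ x, 0 < φ x)
    (heq : ∀ x, deriv (fun y => a y * deriv φ y) x + g x * φ x = μ * φ x) (hμ : μ ≤ 0)
    (hδ : 0 < δ) (hfg : ∀ x, ∀ u ∈ Set.Icc (q x - δ) (q x), deriv (f x) u ≤ g x)
    (hsteep : Steeper u₁ u₂) : c₁ ≤ c₂ := by
  by_contra hc
  push Not at hc
  have hcpos : 0 < c₁ - c₂ := sub_pos.2 hc
  obtain ⟨η, hη, hgap⟩ := h₁.exists_gap hL hr₁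
  obtain ⟨η₂, hη₂, hgap₂⟩ := h₂.exists_gap hL hr₂
  obtain ⟨K, hK⟩ := h₂.near_left (lt_min hδ (half_pos hη))
  have hKδ : ∀ t x, x - c₂ * t ≤ K → q x - δ ≤ u₂ t x := fun t x hx => by
    linarith [(abs_lt.1 (hK t x hx)).1, min_le_left δ (η / 2)]
  have hKη : ∀ t x, x - c₂ * t ≤ K → q x - η / 2 ≤ u₂ t x := fun t x hx => by
    linarith [(abs_lt.1 (hK t x hx)).1, min_le_right δ (η / 2)]
  have hcx₁ : ∀ t, Continuous (u₁ t) := fun t => (h₁.solution.diff_x t).continuous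
  have hcx₂ : ∀ t, Continuous (u₂ t) := fun t => (h₂.solution.diff_x t).continuous
  have hall : ∀ T, (∀ t ≤ T, u₁ t (K + c₂ * t) ≤ u₂ t (K + c₂ * t)) →
      ∀ t ≤ T, ∀ x, u₁ t x ≤ u₂ t x := by
    intro T hline t ht x
    rcases le_total (x - c₂ * t) K with hx | hx
    · exact h₁.le_left_of_faster hL ha ha_pos hf h₂ hle hφ hφ_per hφ_pos heq hμ hfg hη hgap hc
        hKδ hKη hline ht hx
    · exact hsteep.le_right (hcx₁ t) (hcx₂ t) (hline t ht) (by linarith)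
  have hcl₁ : Continuous fun t => u₁ t (K + c₂ * t) :=
    h₁.solution.cont.comp (by fun_prop : Continuous fun t : ℝ => (t, K + c₂ * t))
  have hcl₂ : Continuous fun t => u₂ t (K + c₂ * t) :=
    h₂.solution.cont.comp (by fun_prop : Continuous fun t : ℝ => (t, K + c₂ * t))
  -- Contact times on the line; the infimum is the first one.
  set S := {t : ℝ | u₂ t (K + c₂ * t) ≤ u₁ t (K + c₂ * t)} with hS
  have hSne : S.Nonempty := by
    by_contra hempty
    obtain ⟨K₁, hK₁⟩ := h₁.near_left (half_pos hη₂)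
    obtain ⟨K₂, hK₂⟩ := h₂.near_right (half_pos hη₂)
    -- At this time the point moving at the mean speed is left of `K₁` for `u₁` and right of `K₂`
    -- for `u₂`, so `u₁` is near `q` and `u₂` near `r₂`.
    set t := 2 * (|K₁| + |K₂|) / (c₁ - c₂) with ht
    have htc : (c₁ - c₂) * t = 2 * (|K₁| + |K₂|) := mul_div_cancel₀ _ hcpos.ne'
    have h := hall t (fun s _ => by
      by_contra hs
      push Not at hs
      exact hempty ⟨s, hs.le⟩) t le_rfl ((c₁ + c₂) / 2 * t)
    have h3 := (abs_lt.1 (hK₁ t ((c₁ + c₂) / 2 * t)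
      (by linarith [neg_abs_le K₁, abs_nonneg K₂]))).1
    have h4 := (abs_lt.1 (hK₂ t ((c₁ + c₂) / 2 * t)
      (by linarith [le_abs_self K₂, abs_nonneg K₁]))).2
    linarith [hgap₂ ((c₁ + c₂) / 2 * t)]
  have hSbdd : BddBelow S := by
    obtain ⟨K₁, hK₁⟩ := h₁.near_right (half_pos hη)
    refine ⟨(K - K₁) / (c₁ - c₂), fun t ht => ?_⟩
    rw [div_le_iff₀ hcpos]
    by_contra hlt
    push Not at hlt
    have h3 := (abs_lt.1 (hK₁ t (K + c₂ * t) (by linarith))).2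
    have h4 := hKη t (K + c₂ * t) (by linarith)
    have h5 : u₂ t (K + c₂ * t) ≤ u₁ t (K + c₂ * t) := ht
    linarith [hgap (K + c₂ * t)]
  have hTS : sInf S ∈ S := (isClosed_le hcl₂ hcl₁).csInf_mem hSne hSbdd
  set T := sInf S with hT
  have hbefore : ∀ t < T, u₁ t (K + c₂ * t) < u₂ t (K + c₂ * t) := by
    intro t ht
    by_contra h
    push Not at h
    exact absurd (csInf_le hSbdd (show t ∈ S from h)) (not_le.2 ht)
  have hupto : ∀ t ≤ T, u₁ t (K + c₂ * t) ≤ u₂ t (K + c₂ * t) := by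
    have h : closure (Set.Iio T) ⊆ {t | u₁ t (K + c₂ * t) ≤ u₂ t (K + c₂ * t)} :=
      closure_minimal (fun t ht => (hbefore t ht).le) (isClosed_le hcl₁ hcl₂)
    rw [closure_Iio] at h
    exact fun t ht => h ht
  have hlt := h₁.solution.lt_of_le_of_lt ha ha_pos hf h₂.solution (sub_one_lt T)
    (fun t ht => hall T hupto t ht.2) (hbefore _ (sub_one_lt T)) (x₁ := K + c₂ * T)
  exact absurd hTS (not_le.2 hlt)

/-- Two waves with the same nonzero speed, one steeper than the other, agree up to a time
shift. -/
theorem IsPulsatingWave.eq_shift_of_speed_eq (hL : 0 < L) (ha : ContDiff ℝ 2 a)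
    (ha_pos : ∀ x, 0 < a x) (hf : ContDiff ℝ 1 fun z : ℝ × ℝ => f z.1 z.2)
    (h₁ : IsPulsatingWave L a f c r₁ q u₁) (h₂ : IsPulsatingWave L a f c r₂ q u₂)
    (hr₁ : ∀ x, r₁ x < q x) (hr₂ : ∀ x, r₂ x < q x)
    (hle : ∀ t x, u₁ t x ≤ q x) (hφ : ContDiff ℝ 2 φ) (hφ_per : Function.Periodic φ L)
    (hφ_pos : ∀ x, 0 < φ x)
    (heq : ∀ x, deriv (fun y => a y * deriv φ y) x + g x * φ x = μ * φ x) (hμ : μ ≤ 0)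
    (hδ : 0 < δ) (hfg : ∀ x, ∀ u ∈ Set.Icc (q x - δ) (q x), deriv (f x) u ≤ g x)
    (hsteep : Steeper u₁ u₂) (hc : c ≠ 0) : ∃ τ : ℝ, ∀ t x, u₂ t x = u₁ (t + τ) x := by
  have hp : L / c ≠ 0 := div_ne_zero hL.ne' hc
  obtain ⟨η, hη, hgap⟩ := h₁.exists_gap hL hr₁
  obtain ⟨η₂, hη₂, hgap₂⟩ := h₂.exists_gap hL hr₂
  obtain ⟨K, hK⟩ := h₂.near_left (lt_min hδ (half_pos hη))
  have hKδ : ∀ t x, x - c * t ≤ K → q x - δ ≤ u₂ t x := fun t x hx => by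
    linarith [(abs_lt.1 (hK t x hx)).1, min_le_left δ (η / 2)]
  have hcx₁ : ∀ t, Continuous (u₁ t) := fun t => (h₁.solution.diff_x t).continuous
  have hcx₂ : ∀ t, Continuous (u₂ t) := fun t => (h₂.solution.diff_x t).continuous
  -- Dividing by `c` makes `σ` a shift of the wave variable, `x - c * t - σ`, whatever the sign of
  -- `c`: large `σ` brings `u₁` near `q`, very negative `σ` near `r₁`.
  set S := {σ : ℝ | ∀ t x, u₁ (t + σ / c) x ≤ u₂ t x} with hS
  have hline : ∀ σ, (∀ t, u₁ (t + σ / c) (K + c * t) < u₂ t (K + c * t)) → σ ∈ S := by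
    intro σ h t x
    rcases le_total (x - c * t) K with hx | hx
    · exact (h₁.shift (σ / c)).le_left_of_speed_eq hL ha ha_pos hf h₂
        (fun t x => hle (t + σ / c) x) hφ hφ_per hφ_pos heq hμ hfg hc hKδ h hx
    · exact (hsteep.shift (σ / c)).le_right (hcx₁ _) (hcx₂ t) (h t).le (by linarith)
  have hSne : S.Nonempty := by
    obtain ⟨K₁, hK₁⟩ := h₁.near_right (half_pos hη)
    refine ⟨K - K₁, hline _ fun t => ?_⟩
    have h1 : K + c * t - c * (t + (K - K₁) / c) = K₁ := by field_simp; ring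
    have h2 := (abs_lt.1 (hK₁ _ _ h1.ge)).2
    have h3 := (abs_lt.1 (hK t (K + c * t) (by linarith))).1
    linarith [hgap (K + c * t), min_le_right δ (η / 2)]
  have hSbdd : BddAbove S := by
    obtain ⟨K₁, hK₁⟩ := h₁.near_left (half_pos hη₂)
    obtain ⟨K₂, hK₂⟩ := h₂.near_right (half_pos hη₂)
    refine ⟨K₂ - K₁, fun σ hσ => ?_⟩
    by_contra hlt
    push Not at hlt
    have h1 : K₂ - c * (0 + σ / c) = K₂ - σ := by field_simp; ring
    have h2 := (abs_lt.1 (hK₁ (0 + σ / c) K₂ (by linarith))).1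
    have h3 := (abs_lt.1 (hK₂ 0 K₂ (by simp))).2
    linarith [hgap₂ K₂, hσ 0 K₂]
  have hScl : IsClosed S := by
    simp only [hS, Set.ofPred_forall]
    refine isClosed_iInter fun t => isClosed_iInter fun x => isClosed_le ?_ continuous_const
    exact h₁.solution.cont.comp (by fun_prop : Continuous fun σ : ℝ => (t + σ / c, x))
  have hσS : sSup S ∈ S := hScl.csSup_mem hSne hSbdd
  set σ := sSup S with hσ
  refine ⟨σ / c, ?_⟩
  by_contra hne
  push Not at hne
  obtain ⟨t₀, x₀, hne⟩ := hne
  have hlt₀ : u₁ (t₀ + σ / c) x₀ < u₂ t₀ x₀ := lt_of_le_of_ne (hσS t₀ x₀) hne.symm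
  have hshift := h₁.shift (σ / c)
  have hlt : ∀ t x, u₁ (t + σ / c) x < u₂ t x := by
    intro t x
    -- A periodic copy of the point of strict order is moved to a time before `t`, so strictness
    -- spreads to every `(t, x)`.
    obtain ⟨n, hn⟩ := exists_int_shift hp t₀ (t - 1 - |L / c|)
    refine hshift.solution.lt_of_le_of_lt ha ha_pos hf h₂.solution
      (show t₀ + n * (L / c) < t by linarith [hn.2]) (fun t _ x => hσS t x) (x₀ := x₀ + n * L) ?_
    have h1 := hshift.shift_period hc n t₀ x₀
    rw [h1, h₂.shift_period hc]
    exact hlt₀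
  have hev : ∀ᶠ σ' in 𝓝 σ, ∀ t ∈ Set.Icc 0 |L / c|,
      u₁ (t + σ' / c) (K + c * t) < u₂ t (K + c * t) := by
    refine isCompact_Icc.eventually_forall_of_forall_eventually fun t _ => ?_
    have hc₁ : Continuous fun z : ℝ × ℝ => u₁ (z.2 + z.1 / c) (K + c * z.2) :=
      h₁.solution.cont.comp
        (by fun_prop : Continuous fun z : ℝ × ℝ => (z.2 + z.1 / c, K + c * z.2))
    have hc₂ : Continuous fun z : ℝ × ℝ => u₂ z.2 (K + c * z.2) :=
      h₂.solution.cont.comp (by fun_prop : Continuous fun z : ℝ × ℝ => (z.2, K + c * z.2))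
    exact (isOpen_lt hc₁ hc₂).mem_nhds (hlt t (K + c * t))
  obtain ⟨σ', hσ', hgt⟩ := ((hev.filter_mono nhdsWithin_le_nhds).and
    (self_mem_nhdsWithin : ∀ᶠ σ' in 𝓝[>] σ, σ' ∈ Set.Ioi σ)).exists
  refine absurd (le_csSup hSbdd (hline σ' fun t => ?_)) (not_le.2 hgt)
  obtain ⟨n, hn⟩ := exists_int_shift hp t 0
  have h := hσ' (t + n * (L / c)) ⟨hn.1, by simpa using hn.2.le⟩
  rw [show K + c * (t + n * (L / c)) = K + c * t + n * L by field_simp; ring,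
    h₂.shift_period hc] at h
  have h1 := (h₁.shift (σ' / c)).shift_period hc n t (K + c * t)
  rwa [h1] at h

end PeriodicRD

theorem mainTheorem3
    (L : ℝ) (hL : 0 < L)
    (a : ℝ → ℝ) (ha : ContDiff ℝ 2 a) (ha_pos : ∀ x, 0 < a x) (ha_per : Function.Periodic a L)
    (f : ℝ → ℝ → ℝ) (hf : ContDiff ℝ 1 fun z : ℝ × ℝ => f z.1 z.2)
    (hf_per : ∀ x u, f (x + L) u = f x u)
    (q q₁ q₂ : ℝ → ℝ) (hq₁ : ∀ x, q₁ x < q x) (hq₂ : ∀ x, q₂ x < q x)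
    (c₁ c₂ : ℝ) (U₁ U₂ : ℝ → ℝ → ℝ)
    (hU₁ : PeriodicRD.IsPulsatingWave L a f c₁ q₁ q U₁)
    (hU₂ : PeriodicRD.IsPulsatingWave L a f c₂ q₂ q U₂)
    (hU₁q : ∀ t x, U₁ t x ≤ q x)
    (δ : ℝ) (hδ : 0 < δ)
    (g : ℝ → ℝ) (hg : Function.Periodic g L)
    (μ : ℝ) (hμ : PeriodicRD.IsPrincipalEigenvalue L a g μ) (hμ_nonpos : μ ≤ 0)
    (hfg : ∀ x, ∀ u ∈ Set.Icc (q x - δ) (q x), deriv (f x) u ≤ g x)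
    (hsteep : PeriodicRD.Steeper U₁ U₂) :
    c₁ ≤ c₂ ∧
      (c₁ = c₂ → c₁ ≠ 0 → ∃ τ : ℝ, ∀ t x, U₂ t x = U₁ (t + τ) x) := by
  obtain ⟨φ, hφ, hφ_per, hφ_pos, heq⟩ := hμ
  refine ⟨hU₁.speed_le hL ha ha_pos hf hU₂ hq₁ hq₂ hU₁q hφ hφ_per hφ_pos heq hμ_nonpos hδ hfg
    hsteep, ?_⟩
  rintro rfl hc
  exact hU₁.eq_shift_of_speed_eq hL ha ha_pos hf hU₂ hq₁ hq₂ hU₁q hφ hφ_per hφ_pos heq hμ_nonpos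
    hδ hfg hsteep hc
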